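/- A $*$-category is a category with an involution $f\mapsto f^*$ (for $f\colon X\to Y$, $f^*\colon Y\to X$) satisfying $1^*=1$, $(gf)^*=f^*g^*$, $f^{**}=f$. A morphism $f$ is isometric if $f^*f=1$ and coisometric if $ff^*=1$. A pre-Hilbert $*$-category is a $*$-category $\mathcal C$ with a zero object, in which every two objects have an orthonormal product (a product whose projections $p_1,p_2$ are coisometries with $p_1p_2^*=0$), every morphism has an isometric kernel, and every diagonal $\langle 1,1\rangle\colon X\to X\oplus X$ is a kernel of some morphism. Parallel morphisms are added using the resulting biproducts; for Hermitian $f,g\in\mathcal C(A,A)$ (that is, $f=f^*$, $g=g^*$), $f\le g$ means that $g-f=h^*h$ for some morphism $h\colon A\to Z$. Suprema and upper bounds of families of Hermitian endomorphisms refer to this order. $F$ always ranges over the finite subsets of the index set $J$. $\mathcal C$ is monotone complete if, for every object $A$, every increasing net (indexed by a non-empty directed set) of Hermitian elements of $\mathcal C(A,A)$ with an upper bound has a supremum. A family $(x_j)_{j\in J}$ in $\mathcal C(A,X)$ is orthogonal if $x_j^*x_k=0$ for $j\ne k$; it is an $\ell^2$-family if moreover the net $\bigl(\sum_{j\in F}x_j^*x_j\bigr)_F$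 is bounded above. An order sum of an orthogonal family $(x_j)_{j\in J}$ is a morphism $s\colon A\to X$ with $s^*x_j=x_j^*x_j$ for all $j$ and $s^*s=\sup_F\sum_{j\in F}x_j^*x_j$; order sums are unique when they exist. $\mathcal C$ is orthogonally complete if, for all objects $A,X$, every $\ell^2$-family in $\mathcal C(A,X)$ has an order sum. Let $(X_j)_{j\in J}$ be a family of objects. An $\ell^2$-span on it is a span $(g_j\colon Y\to X_j)_{j\in J}$ such that the net $\bigl(\sum_{j\in F}g_j^*g_j\bigr)_F$ is bounded above. An $\ell^2$-product is an $\ell^2$-span $(r_j\colon X\to X_j)_{j\in J}$ such that for every $\ell^2$-span $(g_j\colon Y\to X_j)_{j\in J}$ there is a unique $g\colon Y\to X$ with $r_jg=g_j$ for all $j$, and this $g$ satisfies $g^*g=\sup_F\sum_{j\in F}g_j^*g_j$. An $\ell^2$-biproduct is a span $(r_j\colon X\to X_j)_{j\in J}$ with $r_jr_j^*=1$ for all $j$, $r_jr_k^*=0$ for $j\ne k$, and $\sup_F\sum_{j\in F}r_j^*r_j=1$. **Proposition.** Let $\mathcal C$ be a pre-Hilbert $*$-category that is monotone complete and orthogonally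 complete. Then every $\ell^2$-biproduct $(r_j\colon X\to X_j)_{j\in J}$ in $\mathcal C$ is an $\ell^2$-product. Moreover, for every $\ell^2$-span $(g_j\colon Y\to X_j)_{j\in J}$, the family $(r_j^*g_j)_{j\in J}$ in $\mathcal C(Y,X)$ is orthogonal, and the unique morphism $g\colon Y\to X$ with $r_jg=g_j$ for all $j$ is the order sum $\sum_{j\in J}r_j^*g_j$: a morphism $g\colon Y\to X$ satisfies $r_jg=g_j$ for all $j$ if and only if it is an order sum of $(r_j^*g_j)_{j\in J}$. -/

import Mathlib

open CategoryTheory CategoryTheory.Limits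

universe w v u

/-- A `∗`-category: a category with an involution `f ↦ f*` that is the identity on objects and
reverses morphisms. -/
class StarCategory (C : Type u) [Category.{v} C] where
  /-- The morphism `f* : Y ⟶ X` associated with `f : X ⟶ Y`. -/
  adj {X Y : C} (f : X ⟶ Y) : Y ⟶ X
  adj_id (X : C) : adj (𝟙 X) = 𝟙 X
  adj_comp {X Y Z : C} (f : X ⟶ Y) (g : Y ⟶ Z) : adj (f ≫ g) = adj g ≫ adj f
  adj_adj {X Y : C} (f : X ⟶ Y) : adj (adj f) = f

namespace StarCategory

section

variable {C : Type u} [Category.{v} C] [StarCategory C]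

/-- `f* ∘ f = 1` (Mathlib composes in diagrammatic order). -/
def IsIsometric {X Y : C} (f : X ⟶ Y) : Prop := f ≫ adj f = 𝟙 X

/-- `f ∘ f* = 1`. -/
def IsCoisometric {X Y : C} (f : X ⟶ Y) : Prop := adj f ≫ f = 𝟙 Y

/-- `f* = f`. -/
def IsHermitian {A : C} (f : A ⟶ A) : Prop := adj f = f

/-- `X ← P → Y` is an orthonormal product of `X` and `Y`: a categorical product whose projections
are coisometries with `p₁ ∘ p₂* = 0`. -/
structure IsOrthonormalProduct [HasZeroMorphisms C] {X Y P : C} (p₁ : P ⟶ X) (p₂ : P ⟶ Y) :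
    Prop where
  isProduct : Nonempty (IsLimit (BinaryFan.mk p₁ p₂))
  coisometric_fst : IsCoisometric p₁
  coisometric_snd : IsCoisometric p₂
  orthogonal : adj p₂ ≫ p₁ = 0

end

end StarCategory

open StarCategory

/-- A pre-Hilbert `∗`-category: a `∗`-category with a zero object, binary orthonormal products and
isometric kernels, in which every diagonal `⟨1, 1⟩ : X ⟶ X ⊕ X` is a kernel (of some morphism).
The zero morphisms are the ones that factor through the zero object; they are unique. -/
class PreHilbertStarCategory (C : Type u) [Category.{v} C]
    extends StarCategory C, HasZeroMorphisms C where
  hasZeroObject : HasZeroObject C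
  exists_orthonormalProduct (X Y : C) :
    ∃ (P : C) (p₁ : P ⟶ X) (p₂ : P ⟶ Y), IsOrthonormalProduct p₁ p₂
  exists_isometric_kernel {X Y : C} (f : X ⟶ Y) :
    ∃ (K : C) (k : K ⟶ X) (hk : k ≫ f = 0),
      Nonempty (IsLimit (KernelFork.ofι k hk)) ∧ IsIsometric k
  diagonal_isKernel {X P : C} (p₁ p₂ : P ⟶ X) (_ : IsOrthonormalProduct p₁ p₂)
    (d : X ⟶ P) (_ : d ≫ p₁ = 𝟙 X) (_ : d ≫ p₂ = 𝟙 X) : Nonempty (NormalMono d)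

namespace PreHilbertStarCategory

variable {C : Type u} [Category.{v} C] [PreHilbertStarCategory C]

theorem adj_zero (X Y : C) : adj (0 : X ⟶ Y) = 0 := by
  have h := (hasZeroObject (C := C))
  obtain ⟨Z, hZ⟩ := h.zero
  have e : (0 : X ⟶ Y) = (0 : X ⟶ Z) ≫ (0 : Z ⟶ Y) := by simp
  rw [e, adj_comp, hZ.eq_of_tgt (adj (0 : Z ⟶ Y)) 0, zero_comp]

/-- An orthonormal product is a biproduct with injections `p₁*` and `p₂*`. -/
instance hasBinaryBiproducts : HasBinaryBiproducts C where
  has_binary_biproduct X Y := by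
    obtain ⟨P, p₁, p₂, h⟩ := exists_orthonormalProduct X Y
    obtain ⟨l⟩ := h.isProduct
    have h12 : adj p₁ ≫ p₂ = 0 := by
      have := congrArg adj h.orthogonal
      rwa [adj_comp, adj_adj, adj_zero] at this
    refine HasBinaryBiproduct.mk
      { bicone :=
          { pt := P, fst := p₁, snd := p₂, inl := adj p₁, inr := adj p₂
            inl_fst := h.coisometric_fst
            inl_snd := h12
            inr_fst := h.orthogonal
            inr_snd := h.coisometric_snd }
        isBilimit :=
          { isLimit := l
            isColimit := BinaryCofan.IsColimit.mk _
              (fun f g => adj (l.lift (BinaryFan.mk (adj f) (adj g)))) ?_ ?_ ?_ } }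
    · intro T f g
      have := congrArg adj (l.fac (BinaryFan.mk (adj f) (adj g)) ⟨WalkingPair.left⟩)
      simpa [adj_comp, adj_adj] using this
    · intro T f g
      have := congrArg adj (l.fac (BinaryFan.mk (adj f) (adj g)) ⟨WalkingPair.right⟩)
      simpa [adj_comp, adj_adj] using this
    · intro T f g m hf hg
      change P ⟶ T at m
      rw [← adj_adj m]
      refine congrArg adj (BinaryFan.IsLimit.hom_ext l ?_ ?_)
      · rw [l.fac]
        have := congrArg adj (show adj p₁ ≫ m = f from hf)
        rw [adj_comp, adj_adj] at this
        exact this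
      · rw [l.fac]
        have := congrArg adj (show adj p₂ ≫ m = g from hg)
        rw [adj_comp, adj_adj] at this
        exact this

/-- The canonical addition of parallel morphisms, `f + g = [f, g] ∘ ⟨1, 1⟩`, coming from
biproducts. -/
noncomputable instance homAddCommMonoid (X Y : C) : AddCommMonoid (X ⟶ Y) :=
  SemiadditiveOfBinaryBiproducts.addCommMonoidHomOfHasBinaryBiproducts X Y

/-- The order on (Hermitian) endomorphisms: `f ≤ g` if and only if `g - f = h* ∘ h` for some
morphism `h : A ⟶ Z`. The equation is written without subtraction. If `f` is Hermitian and
`f ≤ g`, then `g` is Hermitian. -/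
def StarLE {A : C} (f g : A ⟶ A) : Prop := ∃ (Z : C) (h : A ⟶ Z), f + h ≫ adj h = g

/-- The family `a` of endomorphisms of `A` has an upper bound. -/
def IsBoundedAbove {ι : Type w} {A : C} (a : ι → (A ⟶ A)) : Prop :=
  ∃ b : A ⟶ A, ∀ i, StarLE (a i) b

/-- `s` is the supremum (least upper bound) of the family `a` of endomorphisms of `A`. -/
def IsSup {ι : Type w} {A : C} (a : ι → (A ⟶ A)) (s : A ⟶ A) : Prop :=
  (∀ i, StarLE (a i) s) ∧ ∀ b : A ⟶ A, (∀ i, StarLE (a i) b) → StarLE s b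

variable (C) in
/-- For every object `A`, every increasing net of Hermitian endomorphisms of `A` that has an upper
bound has a supremum. The parameter `w` is the universe of the index sets of nets. -/
def MonotoneComplete : Prop :=
  ∀ (A : C) (I : Type w) [Preorder I] [IsDirectedOrder I] [Nonempty I] (a : I → (A ⟶ A)),
    (∀ i, IsHermitian (a i)) → (∀ i j, i ≤ j → StarLE (a i) (a j)) →
      IsBoundedAbove a → ∃ s, IsSup a s

/-- The `C(A, A)`-valued inner product `⟨f, g⟩ = f* ∘ g` on `C(A, X)`. -/
def homInner {A X : C} (f g : A ⟶ X) : A ⟶ A := g ≫ adj f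

/-- A family in `C(A, X)` of pairwise orthogonal elements. -/
def IsOrthogonalFamily {J : Type w} {A X : C} (x : J → (A ⟶ X)) : Prop :=
  ∀ j k, j ≠ k → homInner (x j) (x k) = 0

/-- The net of finite partial sums `∑_{j ∈ F} |x_j|²`, indexed by the finite subsets `F` of `J`. It
makes sense for a span `x`, that is, for morphisms with different codomains. -/
noncomputable def sqSum {J : Type w} {A : C} {X : J → C} (x : ∀ j, A ⟶ X j) (F : Finset J) :
    A ⟶ A :=
  ∑ j ∈ F, homInner (x j) (x j)

/-- `s` is an order sum of the orthogonal family `x` in `C(A, X)`. -/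
structure IsOrderSum {J : Type w} {A X : C} (x : J → (A ⟶ X)) (s : A ⟶ X) : Prop where
  orthogonal : IsOrthogonalFamily x
  inner_eq : ∀ j, homInner s (x j) = homInner (x j) (x j)
  isSup : IsSup (sqSum x) (homInner s s)

/-- An `ℓ²`-family in `C(A, X)`: an orthogonal family for which the net of the sums
`∑_{j ∈ F} |x_j|²` is bounded above. -/
structure IsL2Family {J : Type w} {A X : C} (x : J → (A ⟶ X)) : Prop where
  orthogonal : IsOrthogonalFamily x
  bounded : IsBoundedAbove (sqSum x)

variable (C) in
/-- For all objects `A` and `X`, every `ℓ²`-family in `C(A, X)` has an order sum. The parameter `w`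
is the universe of the index sets of families. -/
def OrthogonallyComplete : Prop :=
  ∀ (A X : C) (J : Type w) (x : J → (A ⟶ X)), IsL2Family x → ∃ s, IsOrderSum x s

/-- An `ℓ²`-span on `(X_j)`: a span `(g_j : Y ⟶ X_j)` such that the net of the sums
`∑_{j ∈ F} g_j* ∘ g_j` is bounded above. -/
def IsL2Span {J : Type w} {X : J → C} {Y : C} (g : ∀ j, Y ⟶ X j) : Prop :=
  IsBoundedAbove (sqSum g)

/-- `(r_j : P ⟶ X_j)` is an `ℓ²`-product of `(X_j)`. -/
structure IsL2Product {J : Type w} {X : J → C} {P : C} (r : ∀ j, P ⟶ X j) : Prop where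
  isL2Span : IsL2Span r
  existsUnique : ∀ (Y : C) (g : ∀ j, Y ⟶ X j), IsL2Span g → ∃! m : Y ⟶ P, ∀ j, m ≫ r j = g j
  isSup : ∀ (Y : C) (g : ∀ j, Y ⟶ X j), IsL2Span g →
    ∀ m : Y ⟶ P, (∀ j, m ≫ r j = g j) → IsSup (sqSum g) (m ≫ adj m)

/-- `(r_j : P ⟶ X_j)` is an `ℓ²`-biproduct of `(X_j)`: `r_j ∘ r_k*` is `1` if `j = k` and `0`
otherwise, and the supremum of the sums `∑_{j ∈ F} r_j* ∘ r_j` is `1`. -/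
structure IsL2Biproduct {J : Type w} {X : J → C} {P : C} (r : ∀ j, P ⟶ X j) : Prop where
  adj_comp_self : ∀ j, adj (r j) ≫ r j = 𝟙 (X j)
  adj_comp_of_ne : ∀ j k, j ≠ k → adj (r k) ≫ r j = 0
  isSup : IsSup (sqSum r) (𝟙 P)

end PreHilbertStarCategory

namespace PreHilbertStarCategory

variable {C : Type u} [Category.{v} C] [PreHilbertStarCategory C]

/-! The key fact is `IsSup.conj`: under monotone completeness, `a ↦ m* a m` preserves suprema of
increasing Hermitian nets. Applied to `1 = sup_F ∑ r_j* r_j`, it gives the Parseval identity `m* m =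
sup_F ∑ |r_j m|²` for every `m : Y ⟶ P` (`IsL2Biproduct.isSup_comp`). Hence `m` vanishes when all
its coordinates `r_j m` do, which gives uniqueness, and an `m` with coordinates `g_j` is an order
sum of the `r_j* g_j`.

Conversely, if `s` is such an order sum and `d_j = r_j s - g_j`, Pythagoras gives `|r_j s|² = |g_j|²
+ |d_j|²`. A nonzero `d_j` would allow a smaller upper bound than the supremum `s* s`. Orthogonal
completeness supplies the order sum, hence existence. The subtraction used throughout comes from
diagonals being kernels (`exists_id_add_eq_zero`). -/

theorem hom_add_comp {X Y Z : C} (f g : X ⟶ Y) (h : Y ⟶ Z) : (f + g) ≫ h = f ≫ h + g ≫ h :=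
  SemiadditiveOfBinaryBiproducts.add_comp f g h

theorem hom_comp_add {X Y Z : C} (f : X ⟶ Y) (g h : Y ⟶ Z) : f ≫ (g + h) = f ≫ g + f ≫ h :=
  SemiadditiveOfBinaryBiproducts.comp_add f g h

theorem hom_sum_comp {ι : Type*} {X Y Z : C} (s : Finset ι) (f : ι → (X ⟶ Y)) (h : Y ⟶ Z) :
    (∑ i ∈ s, f i) ≫ h = ∑ i ∈ s, f i ≫ h :=
  map_sum (⟨⟨fun f => f ≫ h, zero_comp⟩, fun f g => hom_add_comp f g h⟩ : (X ⟶ Y) →+ (X ⟶ Z)) f s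

theorem hom_comp_sum {ι : Type*} {X Y Z : C} (s : Finset ι) (f : ι → (Y ⟶ Z)) (h : X ⟶ Y) :
    h ≫ (∑ i ∈ s, f i) = ∑ i ∈ s, h ≫ f i :=
  map_sum (⟨⟨fun f => h ≫ f, comp_zero⟩, fun f g => hom_comp_add h f g⟩ : (Y ⟶ Z) →+ (X ⟶ Z)) f s

theorem adj_comp_eq_zero_symm {X Y Z : C} {f : X ⟶ Y} {g : X ⟶ Z} (h : adj f ≫ g = 0) :
    adj g ≫ f = 0 := by
  simpa [adj_comp, adj_adj, adj_zero] using congrArg adj h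

/-! ### Orthonormal products, additivity of the involution, and negatives. -/

section

variable {X Y P : C} {p : P ⟶ X} {q : P ⟶ Y}

theorem orthonormalProduct_total (h : IsOrthonormalProduct p q) :
    p ≫ adj p + q ≫ adj q = 𝟙 P := by
  obtain ⟨l⟩ := h.isProduct
  have h1 : adj p ≫ p = 𝟙 X := h.coisometric_fst
  have h2 : adj q ≫ q = 𝟙 Y := h.coisometric_snd
  refine BinaryFan.IsLimit.hom_ext l ?_ ?_
  · change (p ≫ adj p + q ≫ adj q) ≫ p = 𝟙 P ≫ p
    simp [hom_add_comp, h1, h.orthogonal]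
  · change (p ≫ adj p + q ≫ adj q) ≫ q = 𝟙 P ≫ q
    simp [hom_add_comp, h2, adj_comp_eq_zero_symm h.orthogonal]

theorem orthonormalProduct_desc_eq (h : IsOrthonormalProduct p q) {Z : C} (f : P ⟶ Z) :
    p ≫ adj p ≫ f + q ≫ adj q ≫ f = f := by
  have := congrArg (· ≫ f) (orthonormalProduct_total h)
  simpa [hom_add_comp] using this

end

/-- The sum factors through an orthonormal product as a diagonal followed by a copairing; the
adjoints of both factors are computed by components. -/
theorem adj_add {X Y : C} (f g : X ⟶ Y) : adj (f + g) = adj f + adj g := by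
  obtain ⟨P, p, q, h⟩ := exists_orthonormalProduct X X
  have h1 : adj p ≫ p = 𝟙 X := h.coisometric_fst
  have h2 : adj q ≫ q = 𝟙 X := h.coisometric_snd
  have h3 := h.orthogonal
  have h4 := adj_comp_eq_zero_symm h3
  have hd : adj (adj p + adj q) = p + q := by
    rw [← orthonormalProduct_desc_eq h (adj (adj p + adj q)), ← adj_comp, ← adj_comp]
    simp [hom_add_comp, h1, h2, h3, h4, adj_id]
  have he : adj (p ≫ f + q ≫ g) = adj f ≫ adj p + adj g ≫ adj q := by
    have a1 : adj (p ≫ f + q ≫ g) ≫ p = adj f := by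
      rw [← adj_adj p, ← adj_comp, adj_adj p, hom_comp_add, ← Category.assoc, ← Category.assoc,
        h1, h4]
      simp
    have a2 : adj (p ≫ f + q ≫ g) ≫ q = adj g := by
      rw [← adj_adj q, ← adj_comp, adj_adj q, hom_comp_add, ← Category.assoc, ← Category.assoc,
        h2, h3]
      simp
    rw [← Category.comp_id (adj (p ≫ f + q ≫ g)), ← orthonormalProduct_total h, hom_comp_add,
      reassoc_of% a1, reassoc_of% a2]
  have : f + g = (adj p + adj q) ≫ (p ≫ f + q ≫ g) := by
    simp [hom_add_comp, hom_comp_add, reassoc_of% h1, reassoc_of% h2, reassoc_of% h3,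
      reassoc_of% h4]
  rw [this, adj_comp, hd, he]
  simp [hom_add_comp, hom_comp_add, h1, h2, h3, h4]

/-- The isometric kernel of the codiagonal `p + q` has adjoint components `a`, `b` with `a + b = 0`.
It will turn out that `2aa* = 1` in diagrammatic order, so `2ba*` is the negative of `1`. -/
theorem exists_id_add_eq_zero (X : C) : ∃ n : X ⟶ X, 𝟙 X + n = 0 := by
  obtain ⟨P, p, q, h⟩ := exists_orthonormalProduct X X
  have h1 : adj p ≫ p = 𝟙 X := h.coisometric_fst
  have h2 : adj q ≫ q = 𝟙 X := h.coisometric_snd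
  have h3 := h.orthogonal
  have h4 := adj_comp_eq_zero_symm h3
  have hdp : (adj p + adj q) ≫ p = 𝟙 X := by simp [hom_add_comp, h1, h3]
  have hdq : (adj p + adj q) ≫ q = 𝟙 X := by simp [hom_add_comp, h2, h4]
  obtain ⟨D⟩ := diagonal_isKernel p q h (adj p + adj q) hdp hdq
  obtain ⟨L, j, hj, ⟨l⟩, hiso⟩ := exists_isometric_kernel (p + q)
  obtain ⟨t, ht⟩ : ∃ t : D.Z ⟶ L, t ≫ j = adj D.g := by
    have hz : adj D.g ≫ (p + q) = 0 := by
      have := congrArg adj D.w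
      rwa [adj_comp, adj_add, adj_adj, adj_adj, adj_zero] at this
    exact ⟨l.lift (KernelFork.ofι _ hz), l.fac (KernelFork.ofι _ hz) WalkingParallelPair.zero⟩
  have hDg : D.g = adj j ≫ adj t := by rw [← adj_comp, ht, adj_adj]
  set a : X ⟶ L := adj (j ≫ p) with ha
  set b : X ⟶ L := adj (j ≫ q) with hb
  have hab : a + b = 0 := by rw [ha, hb, ← adj_add, ← hom_comp_add, hj, adj_zero]
  -- If `x ≫ a = y ≫ a`, the pair `(x, y)` is killed by `D.g`, so it factors through the diagonal.
  have hmonic : ∀ {Z : C} (x y : Z ⟶ X), x ≫ a = y ≫ a → x = y := by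
    intro Z x y hxy
    have hz : (x ≫ adj p + y ≫ adj q) ≫ D.g = 0 := by
      rw [hDg, ← Category.assoc, hom_add_comp, Category.assoc, Category.assoc, ← adj_comp,
        ← adj_comp, ← ha, ← hb, hxy, ← hom_comp_add, hab]
      simp
    have hw := D.isLimit.fac (KernelFork.ofι _ hz) WalkingParallelPair.zero
    generalize D.isLimit.lift (KernelFork.ofι _ hz) = m at hw
    change m ≫ (adj p + adj q) = x ≫ adj p + y ≫ adj q at hw
    have e1 := congrArg (· ≫ p) hw
    have e2 := congrArg (· ≫ q) hw
    simp [hom_add_comp, h1, h2, h3, h4] at e1 e2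
    exact e1.symm.trans e2
  have hone : adj a ≫ a + adj b ≫ b = 𝟙 L := by
    have := orthonormalProduct_desc_eq h (adj j)
    have e := congrArg (j ≫ ·) this
    have hiso' : j ≫ adj j = 𝟙 L := hiso
    simpa [hom_comp_add, ha, hb, adj_comp, adj_adj, hiso'] using e
  -- Both sides are additive inverses of `adj a ≫ b`, so they agree without any cancellation law.
  have heq : adj a ≫ a = adj b ≫ b := by
    have e1 : adj a ≫ a + adj a ≫ b = 0 := by rw [← hom_comp_add, hab, comp_zero]
    have e2 : adj a ≫ b + adj b ≫ b = 0 := by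
      rw [← hom_add_comp, ← adj_add, hab, adj_zero, zero_comp]
    calc adj a ≫ a = adj a ≫ a + (adj a ≫ b + adj b ≫ b) := by rw [e2, add_zero]
      _ = adj b ≫ b := by rw [← add_assoc, e1, zero_add]
  have htwo : a ≫ adj a + a ≫ adj a = 𝟙 X := by
    apply hmonic
    rw [hom_add_comp, Category.assoc, ← hom_comp_add]
    nth_rewrite 2 [heq]
    rw [hone, Category.comp_id, Category.id_comp]
  refine ⟨b ≫ adj a + b ≫ adj a, ?_⟩
  rw [← htwo, add_add_add_comm, ← hom_add_comp, hab]
  simp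

noncomputable instance homNeg (X Y : C) : Neg (X ⟶ Y) :=
  ⟨fun f => (exists_id_add_eq_zero X).choose ≫ f⟩

/-- The morphisms of a pre-Hilbert `∗`-category have negatives. -/
noncomputable instance homAddCommGroup (X Y : C) : AddCommGroup (X ⟶ Y) :=
  { homAddCommMonoid X Y, homNeg X Y with
    zsmul := zsmulRec
    neg_add_cancel := fun f => by
      change (exists_id_add_eq_zero X).choose ≫ f + f = 0
      rw [add_comm]
      nth_rewrite 1 [← Category.id_comp f]
      rw [← hom_add_comp, (exists_id_add_eq_zero X).choose_spec, zero_comp] }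

theorem hom_neg_comp {X Y Z : C} (f : X ⟶ Y) (g : Y ⟶ Z) : (-f) ≫ g = -(f ≫ g) :=
  eq_neg_of_add_eq_zero_left (by rw [← hom_add_comp, neg_add_cancel, zero_comp])

theorem hom_comp_neg {X Y Z : C} (f : X ⟶ Y) (g : Y ⟶ Z) : f ≫ (-g) = -(f ≫ g) :=
  eq_neg_of_add_eq_zero_left (by rw [← hom_comp_add, neg_add_cancel, comp_zero])

theorem hom_sub_comp {X Y Z : C} (f g : X ⟶ Y) (h : Y ⟶ Z) : (f - g) ≫ h = f ≫ h - g ≫ h := by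
  rw [sub_eq_add_neg, hom_add_comp, hom_neg_comp, ← sub_eq_add_neg]

theorem hom_comp_sub {X Y Z : C} (f : X ⟶ Y) (g h : Y ⟶ Z) : f ≫ (g - h) = f ≫ g - f ≫ h := by
  rw [sub_eq_add_neg, hom_comp_add, hom_comp_neg, ← sub_eq_add_neg]

theorem adj_neg {X Y : C} (f : X ⟶ Y) : adj (-f) = -adj f :=
  eq_neg_of_add_eq_zero_left (by rw [← adj_add, neg_add_cancel, adj_zero])

theorem adj_sub {X Y : C} (f g : X ⟶ Y) : adj (f - g) = adj f - adj g := by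
  rw [sub_eq_add_neg, adj_add, adj_neg, ← sub_eq_add_neg]

theorem eq_zero_of_comp_adj_eq_zero {X Y : C} {h : X ⟶ Y} (hh : h ≫ adj h = 0) : h = 0 := by
  obtain ⟨K, k, hk, ⟨l⟩, hiso⟩ := exists_isometric_kernel (adj h)
  obtain ⟨t, hfac⟩ : ∃ t : X ⟶ K, t ≫ k = h :=
    ⟨l.lift (KernelFork.ofι _ hh), l.fac (KernelFork.ofι _ hh) WalkingParallelPair.zero⟩
  have h0 : h ≫ adj k = 0 := by
    simpa [adj_comp, adj_adj, adj_zero] using congrArg adj hk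
  have hiso' : k ≫ adj k = 𝟙 K := hiso
  have : t = 0 := by rw [← hfac, Category.assoc, hiso', Category.comp_id] at h0; exact h0
  rw [← hfac, this, zero_comp]

theorem exists_comp_adj_add {A Y Z : C} (h : A ⟶ Y) (k : A ⟶ Z) :
    ∃ (W : C) (l : A ⟶ W), l ≫ adj l = h ≫ adj h + k ≫ adj k := by
  obtain ⟨P, p, q, H⟩ := exists_orthonormalProduct Y Z
  have h1 : adj p ≫ p = 𝟙 Y := H.coisometric_fst
  have h2 : adj q ≫ q = 𝟙 Z := H.coisometric_snd
  refine ⟨P, h ≫ adj p + k ≫ adj q, ?_⟩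
  simp [adj_add, adj_comp, adj_adj, hom_add_comp, hom_comp_add, reassoc_of% h1, reassoc_of% h2,
    reassoc_of% H.orthogonal, reassoc_of% (adj_comp_eq_zero_symm H.orthogonal)]

/-! ### The order on endomorphisms. -/

section

variable {A : C} {a b c d : A ⟶ A}

theorem starLE_iff : StarLE a b ↔ ∃ (Z : C) (h : A ⟶ Z), h ≫ adj h = b - a := by
  simp only [StarLE, eq_sub_iff_add_eq']

theorem starLE_iff_sub : StarLE a b ↔ StarLE 0 (b - a) := by
  rw [starLE_iff, starLE_iff, sub_zero]

/-- Only the difference matters, so inequalities can be rearranged by `abel`. -/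
theorem starLE_of_sub_eq (h : StarLE a b) (e : b - a = d - c) : StarLE c d := by
  rw [starLE_iff_sub] at h ⊢
  rwa [← e]

theorem zero_starLE_comp_adj {Z : C} (h : A ⟶ Z) : StarLE 0 (h ≫ adj h) := ⟨Z, h, zero_add _⟩

theorem StarLE.refl (a : A ⟶ A) : StarLE a a := ⟨A, 0, by simp⟩

theorem StarLE.trans (h₁ : StarLE a b) (h₂ : StarLE b c) : StarLE a c := by
  obtain ⟨Y, h, rfl⟩ := h₁
  obtain ⟨Z, k, rfl⟩ := h₂
  obtain ⟨W, l, hl⟩ := exists_comp_adj_add h k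
  exact ⟨W, l, by rw [hl, add_assoc]⟩

theorem StarLE.add (h₁ : StarLE a b) (h₂ : StarLE c d) : StarLE (a + c) (b + d) := by
  refine (starLE_of_sub_eq (d := b + c) h₁ ?_).trans (starLE_of_sub_eq h₂ ?_) <;> abel

theorem StarLE.antisymm (h₁ : StarLE a b) (h₂ : StarLE b a) : a = b := by
  obtain ⟨Y, h, rfl⟩ := h₁
  obtain ⟨Z, k, hk⟩ := h₂
  obtain ⟨P, p, q, H⟩ := exists_orthonormalProduct Y Z
  have h1 : adj p ≫ p = 𝟙 Y := H.coisometric_fst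
  have h2 : adj q ≫ q = 𝟙 Z := H.coisometric_snd
  -- The pairing of `h` and `k` has square `|h|² + |k|² = 0`.
  have hl : h ≫ adj p + k ≫ adj q = 0 := by
    apply eq_zero_of_comp_adj_eq_zero
    rw [add_assoc, add_eq_left] at hk
    rw [← hk]
    simp [adj_add, adj_comp, adj_adj, hom_add_comp, hom_comp_add, reassoc_of% h1, reassoc_of% h2,
      reassoc_of% H.orthogonal, reassoc_of% (adj_comp_eq_zero_symm H.orthogonal)]
  have := congrArg (· ≫ p) hl
  simp [hom_add_comp, h1, H.orthogonal] at this
  simp [this]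

theorem StarLE.conj (h : StarLE a b) {B : C} (m : B ⟶ A) :
    StarLE (m ≫ a ≫ adj m) (m ≫ b ≫ adj m) := by
  obtain ⟨Z, k, rfl⟩ := h
  exact ⟨Z, m ≫ k, by simp [adj_comp, hom_add_comp, hom_comp_add]⟩

theorem eq_zero_of_comp_adj_starLE_zero {Z : C} {h : A ⟶ Z} (hh : StarLE (h ≫ adj h) 0) : h = 0 :=
  eq_zero_of_comp_adj_eq_zero (hh.antisymm (zero_starLE_comp_adj h))

end

/-! ### Suprema under addition and conjugation. -/

section

variable {I : Type w} {A B : C} {a b : I → (A ⟶ A)} {s t : A ⟶ A}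

theorem IsSup.add [Preorder I] [IsDirectedOrder I] (ha : ∀ i j, i ≤ j → StarLE (a i) (a j))
    (hb : ∀ i j, i ≤ j → StarLE (b i) (b j)) (hs : IsSup a s) (ht : IsSup b t) :
    IsSup (fun i => a i + b i) (s + t) := by
  refine ⟨fun i => (hs.1 i).add (ht.1 i), fun c hc => ?_⟩
  -- Directedness decouples the two indices, so the suprema can be taken one at a time.
  have h1 : ∀ i j, StarLE (a i) (c - b j) := fun i j => by
    obtain ⟨k, hik, hjk⟩ := exists_ge_ge i j
    exact starLE_of_sub_eq (((ha i k hik).add (hb j k hjk)).trans (hc k)) (by abel)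
  have h2 : ∀ j, StarLE (b j) (c - s) := fun j =>
    starLE_of_sub_eq (hs.2 _ fun i => h1 i j) (by abel)
  exact starLE_of_sub_eq (ht.2 _ h2) (by abel)

theorem IsSup.conj_iso (hs : IsSup a s) (u : B ⟶ A) (v : A ⟶ B) (huv : u ≫ v = 𝟙 B)
    (hvu : v ≫ u = 𝟙 A) : IsSup (fun i => u ≫ a i ≫ adj u) (u ≫ s ≫ adj u) := by
  have huv' : adj v ≫ adj u = 𝟙 B := by rw [← adj_comp, huv, adj_id]
  have hvu' : adj u ≫ adj v = 𝟙 A := by rw [← adj_comp, hvu, adj_id]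
  refine ⟨fun i => (hs.1 i).conj u, fun c hc => ?_⟩
  have h1 : StarLE s (v ≫ c ≫ adj v) := hs.2 _ fun i => by
    simpa [reassoc_of% hvu, hvu'] using (hc i).conj v
  simpa [reassoc_of% huv, huv'] using h1.conj u

variable [Preorder I] [IsDirectedOrder I] [Nonempty I]

/-- Monotone completeness provides some supremum `t` on `P`. The gap between `t` and the expected
value is a square `|h|²`, and both components of `h` vanish: compression to `Y` kills the net, and
compression to `A` gives an upper bound of `a`. -/
theorem IsSup.conj_fst (hmono : MonotoneComplete.{w} C) (ha : ∀ i, IsHermitian (a i))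
    (hinc : ∀ i j, i ≤ j → StarLE (a i) (a j)) (hs : IsSup a s) {Y P : C} {p : P ⟶ A} {q : P ⟶ Y}
    (H : IsOrthonormalProduct p q) : IsSup (fun i => p ≫ a i ≫ adj p) (p ≫ s ≫ adj p) := by
  have h1 : adj p ≫ p = 𝟙 A := H.coisometric_fst
  have h3 := H.orthogonal
  obtain ⟨t, ht⟩ := hmono P I (fun i => p ≫ a i ≫ adj p)
    (fun i => by
      have := ha i
      rw [IsHermitian] at this ⊢
      simp [adj_comp, adj_adj, this])
    (fun i j hij => (hinc i j hij).conj p) ⟨p ≫ s ≫ adj p, fun i => (hs.1 i).conj p⟩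
  obtain ⟨Z, h, hh⟩ := ht.2 _ fun i => (hs.1 i).conj p
  have hq : adj q ≫ h = 0 := by
    obtain ⟨i⟩ := ‹Nonempty I›
    have e1 := (ht.1 i).conj (adj q)
    have e2 := congrArg (fun x => adj q ≫ x ≫ q) hh
    simp only [adj_adj, Category.assoc, reassoc_of% h3, zero_comp, hom_add_comp, hom_comp_add]
      at e1 e2
    apply eq_zero_of_comp_adj_starLE_zero
    refine starLE_of_sub_eq e1 ?_
    simpa [adj_comp, adj_adj] using (neg_eq_of_add_eq_zero_left e2).symm
  have hp : adj p ≫ h = 0 := by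
    have e1 : StarLE s (adj p ≫ t ≫ p) := hs.2 _ fun i => by
      simpa [adj_adj, reassoc_of% h1, h1] using (ht.1 i).conj (adj p)
    have e2 := congrArg (fun x => adj p ≫ x ≫ p) hh
    simp only [Category.assoc, reassoc_of% h1, h1, Category.comp_id, hom_add_comp, hom_comp_add]
      at e2
    apply eq_zero_of_comp_adj_starLE_zero
    refine starLE_of_sub_eq e1 ?_
    rw [← e2]
    simp [adj_comp, adj_adj]
  have h0 : h = 0 := by rw [← orthonormalProduct_desc_eq H h, hp, hq]; simp
  rw [h0, zero_comp, add_zero] at hh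
  rwa [← hh]

/-- In a monotone complete pre-Hilbert `∗`-category, suprema of increasing nets of Hermitian
endomorphisms are preserved by conjugation. -/
theorem IsSup.conj (hmono : MonotoneComplete.{w} C) (ha : ∀ i, IsHermitian (a i))
    (hinc : ∀ i j, i ≤ j → StarLE (a i) (a j)) (hs : IsSup a s) (m : B ⟶ A) :
    IsSup (fun i => m ≫ a i ≫ adj m) (m ≫ s ≫ adj m) := by
  refine ⟨fun i => (hs.1 i).conj m, fun b hb => ?_⟩
  obtain ⟨P, p, q, H⟩ := exists_orthonormalProduct A B
  have h1 : adj p ≫ p = 𝟙 A := H.coisometric_fst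
  have h2 : adj q ≫ q = 𝟙 B := H.coisometric_snd
  have h4 := adj_comp_eq_zero_symm H.orthogonal
  have hfst := hs.conj_fst hmono ha hinc H
  -- `p + q ≫ m` is `p` preceded by an invertible shear of `P`, so `IsSup.conj_iso` applies.
  have hshear : IsSup (fun i => (p + q ≫ m) ≫ a i ≫ adj (p + q ≫ m))
      ((p + q ≫ m) ≫ s ≫ adj (p + q ≫ m)) := by
    have hu : (𝟙 P + q ≫ m ≫ adj p) ≫ p = p + q ≫ m := by simp [hom_add_comp, h1]
    have := hfst.conj_iso (𝟙 P + q ≫ m ≫ adj p) (𝟙 P - q ≫ m ≫ adj p)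
      (by simp [hom_add_comp, hom_comp_sub, reassoc_of% h4])
      (by simp [hom_sub_comp, hom_comp_add, reassoc_of% h4])
    simpa only [← hu, adj_comp, Category.assoc] using this
  have hinc' : ∀ (f : P ⟶ A) (i j : I), i ≤ j → StarLE (f ≫ a i ≫ adj f) (f ≫ a j ≫ adj f) :=
    fun f i j hij => (hinc i j hij).conj f
  have hsum := (hshear.add (hinc' _) (hinc' _) hfst)
  have hinc'' : ∀ i j : I, i ≤ j → StarLE
      ((p + q ≫ m) ≫ a i ≫ adj (p + q ≫ m) + p ≫ a i ≫ adj p)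
      ((p + q ≫ m) ≫ a j ≫ adj (p + q ≫ m) + p ≫ a j ≫ adj p) :=
    fun i j hij => (hinc' _ i j hij).add (hinc' _ i j hij)
  -- Parallelogram law for `x = p + q ≫ m` and `y = p`: `|x + y|² + |x - y|² = 2|x|² + 2|y|²`,
  -- weighted by `a i`. Since `x - y = q ≫ m`, bounding that term by `b` and the `x + y` term by `s`
  -- bounds a net whose supremum is known.
  have hle := (hsum.add hinc'' hinc'' hsum).2
    (((p + q ≫ m) ≫ s ≫ adj (p + q ≫ m) + p ≫ s ≫ adj p) +
      ((p + q ≫ m) ≫ s ≫ adj (p + q ≫ m) + p ≫ s ≫ adj p) -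
      q ≫ (m ≫ s ≫ adj m - b) ≫ adj q) fun i => by
    have e1 := (hb i).conj q
    have e2 := (hs.1 i).conj (p + p + q ≫ m)
    refine starLE_of_sub_eq (e1.add e2) ?_
    simp only [adj_add, adj_comp, hom_add_comp, hom_comp_add, hom_sub_comp, hom_comp_sub,
      Category.assoc]
    abel
  have hq : StarLE (q ≫ (m ≫ s ≫ adj m - b) ≫ adj q) 0 := starLE_of_sub_eq hle (by abel)
  have := hq.conj (adj q)
  simp only [adj_adj, Category.assoc, reassoc_of% h2, h2, Category.comp_id, zero_comp, comp_zero]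
    at this
  exact starLE_of_sub_eq this (by abel)

end

/-! ### Parseval's identity and order sums for `ℓ²`-biproducts. -/

section

variable {J : Type w} {X : J → C} {P : C}

theorem sqSum_isHermitian {A : C} (x : ∀ j, A ⟶ X j) (F : Finset J) : IsHermitian (sqSum x F) := by
  classical
  unfold IsHermitian sqSum
  induction F using Finset.induction_on with
  | empty => simp [adj_zero]
  | insert j F hj ih =>
    rw [Finset.sum_insert hj, adj_add, ih]
    simp [homInner, adj_comp, adj_adj]

theorem zero_starLE_sqSum {A : C} (x : ∀ j, A ⟶ X j) (F : Finset J) : StarLE 0 (sqSum x F) := by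
  classical
  induction F using Finset.induction_on with
  | empty => exact StarLE.refl 0
  | insert j F hj ih =>
    rw [sqSum, Finset.sum_insert hj, ← add_zero (0 : A ⟶ A)]
    exact (zero_starLE_comp_adj (x j)).add ih

theorem sqSum_mono {A : C} (x : ∀ j, A ⟶ X j) {F G : Finset J} (h : F ⊆ G) :
    StarLE (sqSum x F) (sqSum x G) := by
  classical
  refine starLE_of_sub_eq (zero_starLE_sqSum x (G \ F)) ?_
  rw [sub_zero, eq_sub_iff_add_eq]
  exact Finset.sum_sdiff h

theorem sqSum_comp {A B : C} (x : ∀ j, A ⟶ X j) (m : B ⟶ A) (F : Finset J) :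
    sqSum (fun j => m ≫ x j) F = m ≫ sqSum x F ≫ adj m := by
  simp [sqSum, homInner, hom_sum_comp, hom_comp_sum, adj_comp]

theorem IsL2Biproduct.isSup_comp (hmono : MonotoneComplete.{w} C) {r : ∀ j, P ⟶ X j}
    (hr : IsL2Biproduct r) {Y : C} (m : Y ⟶ P) :
    IsSup (sqSum fun j => m ≫ r j) (m ≫ adj m) := by
  have := hr.isSup.conj hmono (sqSum_isHermitian r) (fun _ _ h => sqSum_mono r h) m
  rw [Category.id_comp] at this
  rwa [funext (sqSum_comp r m)]

theorem IsL2Biproduct.eq_zero_of_comp_eq_zero (hmono : MonotoneComplete.{w} C) {r : ∀ j, P ⟶ X j}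
    (hr : IsL2Biproduct r) {Y : C} (m : Y ⟶ P) (h : ∀ j, m ≫ r j = 0) : m = 0 := by
  apply eq_zero_of_comp_adj_starLE_zero
  refine (hr.isSup_comp hmono m).2 0 fun F => ?_
  simp only [sqSum, h, homInner, zero_comp, Finset.sum_const_zero]
  exact StarLE.refl 0

theorem IsL2Biproduct.hom_ext (hmono : MonotoneComplete.{w} C) {r : ∀ j, P ⟶ X j}
    (hr : IsL2Biproduct r) {Y : C} {m n : Y ⟶ P} (h : ∀ j, m ≫ r j = n ≫ r j) : m = n :=
  sub_eq_zero.mp <| hr.eq_zero_of_comp_eq_zero hmono _ fun j => by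
    rw [hom_sub_comp, h j, sub_self]

theorem IsL2Biproduct.homInner_comp_adj {r : ∀ j, P ⟶ X j} (hr : IsL2Biproduct r) {Y : C}
    (g : ∀ j, Y ⟶ X j) (j : J) : homInner (g j ≫ adj (r j)) (g j ≫ adj (r j)) =
      homInner (g j) (g j) := by
  simp [homInner, adj_comp, adj_adj, reassoc_of% (hr.adj_comp_self j)]

theorem IsL2Biproduct.sqSum_comp_adj {r : ∀ j, P ⟶ X j} (hr : IsL2Biproduct r) {Y : C}
    (g : ∀ j, Y ⟶ X j) : sqSum (fun j => g j ≫ adj (r j)) = sqSum g :=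
  funext fun _ => Finset.sum_congr rfl fun j _ => hr.homInner_comp_adj g j

theorem IsL2Biproduct.isOrthogonalFamily_comp_adj {r : ∀ j, P ⟶ X j} (hr : IsL2Biproduct r)
    {Y : C} (g : ∀ j, Y ⟶ X j) : IsOrthogonalFamily fun j => g j ≫ adj (r j) := fun j k hjk => by
  simp [homInner, adj_comp, adj_adj, reassoc_of% (hr.adj_comp_of_ne j k hjk)]

theorem IsL2Biproduct.isOrderSum_of_comp_eq (hmono : MonotoneComplete.{w} C) {r : ∀ j, P ⟶ X j}
    (hr : IsL2Biproduct r) {Y : C} {g : ∀ j, Y ⟶ X j} {m : Y ⟶ P} (hm : ∀ j, m ≫ r j = g j) :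
    IsOrderSum (fun j => g j ≫ adj (r j)) m where
  orthogonal := hr.isOrthogonalFamily_comp_adj g
  inner_eq j := by
    rw [hr.homInner_comp_adj]
    simp [homInner, ← adj_comp, hm]
  isSup := by
    have := hr.isSup_comp hmono m
    rw [hr.sqSum_comp_adj]
    rwa [funext hm] at this

theorem IsL2Biproduct.comp_eq_of_isOrderSum (hmono : MonotoneComplete.{w} C) {r : ∀ j, P ⟶ X j}
    (hr : IsL2Biproduct r) {Y : C} {g : ∀ j, Y ⟶ X j} {m : Y ⟶ P}
    (hm : IsOrderSum (fun j => g j ≫ adj (r j)) m) (j : J) : m ≫ r j = g j := by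
  classical
  have hg : IsSup (sqSum g) (m ≫ adj m) := hr.sqSum_comp_adj g ▸ hm.isSup
  have h1 : ∀ k, g k ≫ adj (m ≫ r k) = g k ≫ adj (g k) := fun k => by
    have := hm.inner_eq k
    rw [hr.homInner_comp_adj] at this
    simpa [homInner, adj_comp] using this
  have h2 : ∀ k, (m ≫ r k) ≫ adj (g k) = g k ≫ adj (g k) := fun k => by
    simpa only [adj_comp, adj_adj, Category.assoc] using congrArg adj (h1 k)
  have h3 : ∀ k, (m ≫ r k - g k) ≫ adj (m ≫ r k - g k) =
      (m ≫ r k) ≫ adj (m ≫ r k) - g k ≫ adj (g k) := fun k => by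
    rw [adj_sub, hom_comp_sub, hom_sub_comp, hom_sub_comp, h1, h2]
    abel
  have h4 : ∀ F, sqSum (fun k => m ≫ r k) F = sqSum g F + sqSum (fun k => m ≫ r k - g k) F :=
    fun F => by
      rw [sqSum, sqSum, sqSum, ← Finset.sum_add_distrib]
      refine Finset.sum_congr rfl fun k _ => ?_
      simp only [homInner]
      rw [h3]
      abel
  rw [← sub_eq_zero]
  apply eq_zero_of_comp_adj_starLE_zero
  -- Subtracting `|d_j|²` from `m ≫ adj m` still bounds `sqSum g`; enlarging `F` to contain `j`
  -- makes `|d_j|²` one of the excess terms in `h4`.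
  refine starLE_of_sub_eq (hg.2 (m ≫ adj m - (m ≫ r j - g j) ≫ adj (m ≫ r j - g j))
    fun F => ?_) (by abel)
  have e1 : StarLE (sqSum g F) (sqSum g (insert j F)) := sqSum_mono g (Finset.subset_insert j F)
  have e2 : StarLE ((m ≫ r j - g j) ≫ adj (m ≫ r j - g j))
      (sqSum (fun k => m ≫ r k - g k) (insert j F)) := by
    have := sqSum_mono (fun k => m ≫ r k - g k)
      (Finset.singleton_subset_iff.mpr (Finset.mem_insert_self j F))
    simpa [sqSum, homInner] using this
  have e3 := (hr.isSup_comp hmono m).1 (insert j F)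
  rw [h4] at e3
  exact starLE_of_sub_eq ((e1.add e2).trans e3) (by abel)

end

end PreHilbertStarCategory

open PreHilbertStarCategory in
/-- In a pre-Hilbert `∗`-category that is monotone complete and orthogonally complete, every
`ℓ²`-biproduct is an `ℓ²`-product, and the mediating morphism of an `ℓ²`-span `g` is the order sum
`∑ⱼ r_j* ∘ g_j`. -/
theorem mainTheorem8 {C : Type u} [Category.{v} C] [PreHilbertStarCategory C]
    (hmono : MonotoneComplete.{w} C) (horth : OrthogonallyComplete.{w} C)
    {J : Type w} (X : J → C) (P : C) (r : ∀ j, P ⟶ X j) (hr : IsL2Biproduct r) :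
    IsL2Product r ∧
      ∀ (Y : C) (g : ∀ j, Y ⟶ X j), IsL2Span g → ∀ m : Y ⟶ P,
        (∀ j, m ≫ r j = g j) ↔ IsOrderSum (fun j => g j ≫ StarCategory.adj (r j)) m := by
  refine ⟨⟨⟨𝟙 P, hr.isSup.1⟩, fun Y g hg => ?_, fun Y g _ m hm => ?_⟩,
    fun Y g _ m => ⟨hr.isOrderSum_of_comp_eq hmono, hr.comp_eq_of_isOrderSum hmono⟩⟩
  · have hb : IsBoundedAbove (sqSum fun j => g j ≫ StarCategory.adj (r j)) := by
      rwa [hr.sqSum_comp_adj]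
    obtain ⟨s, hs⟩ := horth Y P J _ ⟨hr.isOrthogonalFamily_comp_adj g, hb⟩
    have hs' := hr.comp_eq_of_isOrderSum hmono hs
    exact ⟨s, hs', fun n hn => hr.hom_ext hmono fun j => (hn j).trans (hs' j).symm⟩
  · have := hr.isSup_comp hmono m
    simpa only [hm] using this
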